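/- Let $k$ be a field (of any characteristic), $n\ge 4$, $A=k[x_1,\dots,x_n]$ and $\mathfrak m=(x_1,\dots,x_n)$. Let $a_{i,j}$ $(1\le i,j\le n)$ be positive integers with $a_{i,i}=\sum_{j\ne i}a_{i,j}$ for every $i$, and let $I=(f_1,\dots,f_n)$ be the associated positive critical binomial ideal, where $f_j=x_j^{a_{j,j}}-\prod_{i\neq j}x_i^{a_{i,j}}$. Put $B=k[x_1^{\pm1},\dots,x_n^{\pm1}]$ and $S(I)=IB\cap A$. For $\alpha\in\mathbb N_0^n$ write $x^\alpha=x_1^{\alpha_1}\cdots x_n^{\alpha_n}$ and $I:(x^\alpha)^\infty=\{f\in A: f\,x^{N\alpha}\in I\text{ for some }N\ge 0\}$. (a) If $\alpha\in\mathbb N_0^n\setminus\{0\}$ satisfies $I:x^\alpha=I:(x^\alpha)^\infty$, then $I+(x^\alpha)$ is an irredundant embedded $\mathfrak m$-primary component of $I$; that is, $I+(x^\alpha)$ is $\mathfrak m$-primary, it is one of the components of some minimal primary decomposition of $I$, and $\mathfrak m$ is not a minimal prime of $I$. Moreover $I=S(I)\cap(I+(x^\alpha))$, and neither ideal can be omitted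 from this intersection. (b) In particular, let $b(n)=(0,\,a_{2,2}-a_{2,3}-\dots-a_{2,n},\,a_{3,3}-a_{3,4}-\dots-a_{3,n},\,\dots,\,a_{n-1,n-1}-a_{n-1,n},\,0)$. Then $b(n)\in\mathbb N_0^n\setminus\{0\}$ and $I:x^{b(n)}=I:(x^{b(n)})^\infty$. Hence $I+(x^{b(n)})$ is an irredundant embedded $\mathfrak m$-primary component of $I$, and $I=S(I)\cap(I+(x^{b(n)}))$, where neither ideal can be omitted. -/

import Mathlib

open MvPolynomial

noncomputable section

namespace PCB

variable {n : ℕ}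

/-- The positive exponents `a i j` of a positive critical binomial (PCB) matrix: the matrix `L` has
diagonal entries `a i i` and off-diagonal entries `-a i j`, and each row of `L` sums to zero. -/
structure IsPCB (a : Matrix (Fin n) (Fin n) ℕ) : Prop where
  pos : ∀ i j, 0 < a i j
  diag_eq : ∀ i, a i i = ∑ j ∈ Finset.univ.erase i, a i j

/-- The monomial `x ^ α = x₁ ^ α₁ ⋯ xₙ ^ αₙ`. -/
def mono (k : Type*) [CommSemiring k] (α : Fin n → ℕ) : MvPolynomial (Fin n) k :=
  ∏ i, X i ^ α i

/-- The binomial `f_j`, read off from the `j`-th column of the matrix. -/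
def binomial (k : Type*) [CommRing k] (a : Matrix (Fin n) (Fin n) ℕ) (j : Fin n) :
    MvPolynomial (Fin n) k :=
  X j ^ a j j - ∏ i ∈ Finset.univ.erase j, X i ^ a i j

/-- The PCB ideal `I = (f₁, …, fₙ)`. -/
def pcbIdeal (k : Type*) [CommRing k] (a : Matrix (Fin n) (Fin n) ℕ) :
    Ideal (MvPolynomial (Fin n) k) :=
  Ideal.span (Set.range (binomial k a))

/-- The ideal `𝔪 = (x₁, …, xₙ)`. -/
def irrelevant (k : Type*) [CommRing k] (n : ℕ) : Ideal (MvPolynomial (Fin n) k) :=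
  Ideal.span (Set.range X)

/-- `S(I) = I B ∩ A`, the contraction of the extension of `I` to the Laurent polynomial ring
`B = A[1 / (x₁ ⋯ xₙ)]`. -/
def laurentContraction {k : Type*} [CommRing k] (I : Ideal (MvPolynomial (Fin n) k)) :
    Ideal (MvPolynomial (Fin n) k) :=
  (I.map (algebraMap (MvPolynomial (Fin n) k)
      (Localization.Away (∏ i, X i : MvPolynomial (Fin n) k)))).comap
    (algebraMap (MvPolynomial (Fin n) k)
      (Localization.Away (∏ i, X i : MvPolynomial (Fin n) k)))

/-- The saturation `I : g ^ ∞`, the set of `f` such that `f * g ^ N ∈ I` for some `N`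
(equivalently, for all large `N`). -/
def saturation {R : Type*} [CommRing R] (I : Ideal R) (g : R) : Ideal R where
  carrier := {f | ∃ N : ℕ, f * g ^ N ∈ I}
  zero_mem' := ⟨0, by simp⟩
  add_mem' := by
    rintro f f' ⟨N, h⟩ ⟨N', h'⟩
    refine ⟨N + N', ?_⟩
    have h1 := I.mul_mem_right (g ^ N') h
    have h2 := I.mul_mem_right (g ^ N) h'
    have e : (f + f') * g ^ (N + N') = f * g ^ N * g ^ N' + f' * g ^ N' * g ^ N := by ring
    rw [e]
    exact I.add_mem h1 h2
  smul_mem' := by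
    rintro c f ⟨N, h⟩
    refine ⟨N, ?_⟩
    have e : c • f * g ^ N = c * (f * g ^ N) := by rw [smul_eq_mul, mul_assoc]
    rw [e]
    exact I.mul_mem_left c h

/-- `q` is an irredundant embedded `p`-primary component of `I`: it is `p`-primary, it occurs in
some minimal (irredundant) primary decomposition of `I`, and `p` is not a minimal prime of `I`. -/
structure IsEmbeddedComponent {R : Type*} [CommRing R] (I p q : Ideal R) : Prop where
  primary : q.IsPrimary
  radical_eq : q.radical = p
  mem_decomposition : ∃ t : Finset (Ideal R), Submodule.IsMinimalPrimaryDecomposition I t ∧ q ∈ t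
  embedded : p ∉ I.minimalPrimes

/-- `I = J ∩ K`, and neither `J` nor `K` can be omitted. -/
structure IsIrredundantInter {R : Type*} [CommRing R] (I J K : Ideal R) : Prop where
  eq_inf : I = J ⊓ K
  left_ne : I ≠ J
  right_ne : I ≠ K

/-- The exponent vector `b(n)`: its first and last entries are `0`, and the `i`-th entry is
`a i i - ∑ j > i, a i j` otherwise. For a PCB matrix the difference is a positive integer, since
`a i i` is the sum of all `a i j` with `j ≠ i`. -/
def lastExponent (a : Matrix (Fin n) (Fin n) ℕ) (i : Fin n) : ℕ :=
  if (i : ℕ) = 0 ∨ (i : ℕ) + 1 = n then 0 else a i i - ∑ j ∈ Finset.Ioi i, a i j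

end PCB

end

noncomputable section
namespace PCB

variable {n : ℕ}

/-! ### Monomials and the exponent matrix. -/

section Monomials

variable {k : Type*} [CommSemiring k]

/-! Modulo `I`, a monomial is a chip configuration: `f_j` lets vertex `j`, if it holds `a j j`
chips, give them up while each other vertex `i` gains `a i j`. The rows sum to zero, so firing every
vertex once changes nothing. Two configurations that differ by the column lattice are joined by
firings of sets through nonnegative configurations. Such a set firing may be illegal vertex by
vertex, but it becomes legal after multiplication by `x^b`, if `b i` covers the `a i j` with `j < i`
at all vertices but one. Hence `x^b` multiplies the kernel of the map to the group algebra of `ℤⁿ`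
modulo the lattice into `I`. Monomials map to units there, so `I : x^b` is saturated
(`colon_eq_saturation`).

For (a), positivity of the `a i j` makes a power of each variable a multiple of `x₁ ⋯ xₙ` modulo
`I`. So every nontrivial monomial has the same saturation `S(I)` (`IsPCB.saturation_eq`), and `I +
(x^α)` has radical `𝔪`. The colon condition then gives `I = S(I) ∩ (I + (x^α))`. This is irredundant
because `I ≠ S(I)` for `n ≥ 4` (`IsPCB.pcbIdeal_ne_laurentContraction`) and `I` contains no
monomial. A positive grading supplies a prime over `I` strictly inside `𝔪`. -/

lemma mono_add (u v : Fin n → ℕ) : mono k (u + v) = mono k u * mono k v := by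
  simp [mono, pow_add, Finset.prod_mul_distrib]

lemma mono_single (j : Fin n) (m : ℕ) : mono k (Pi.single j m) = X j ^ m := by
  rw [mono, Finset.prod_eq_single j]
  · simp
  · intro i _ hi
    simp [hi]
  · simp

lemma mono_eq_monomial (u : Fin n → ℕ) :
    mono k u = monomial (Finsupp.equivFunOnFinite.symm u) 1 := by
  rw [monomial_eq, mono, C_1, one_mul, Finsupp.prod_fintype]
  · simp
  · simp

lemma X_dvd_mono {u : Fin n → ℕ} {j : Fin n} (h : u j ≠ 0) : X j ∣ mono k u :=
  (dvd_pow_self _ h).trans (Finset.dvd_prod_of_mem (fun i => X i ^ u i) (Finset.mem_univ j))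

end Monomials

/-- The integer matrix whose columns are the exponents of the critical binomials. -/
def latticeMatrix (a : Matrix (Fin n) (Fin n) ℕ) : Matrix (Fin n) (Fin n) ℤ :=
  Matrix.of fun i j => if i = j then (a i i : ℤ) else -(a i j : ℤ)

@[simp] lemma latticeMatrix_self (a : Matrix (Fin n) (Fin n) ℕ) (i : Fin n) :
    latticeMatrix a i i = a i i := by
  simp [latticeMatrix]

lemma latticeMatrix_of_ne (a : Matrix (Fin n) (Fin n) ℕ) {i j : Fin n} (h : i ≠ j) :
    latticeMatrix a i j = -(a i j : ℤ) := by
  simp [latticeMatrix, h]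

section Ring

variable {k : Type*} [CommRing k] {a : Matrix (Fin n) (Fin n) ℕ}

/-- The exponent vector of the second monomial of the `j`-th critical binomial. -/
def offDiag (a : Matrix (Fin n) (Fin n) ℕ) (j i : Fin n) : ℕ :=
  if i = j then 0 else a i j

lemma prod_erase_eq_mono (j : Fin n) :
    ∏ i ∈ Finset.univ.erase j, (X i : MvPolynomial (Fin n) k) ^ a i j = mono k (offDiag a j) := by
  rw [mono, ← Finset.mul_prod_erase Finset.univ _ (Finset.mem_univ j)]
  simp only [offDiag, if_true, pow_zero, one_mul]
  refine Finset.prod_congr rfl fun i hi => ?_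
  rw [if_neg (Finset.ne_of_mem_erase hi)]

lemma binomial_eq_mono (j : Fin n) :
    binomial k a j = mono k (Pi.single j (a j j)) - mono k (offDiag a j) := by
  rw [binomial, mono_single, prod_erase_eq_mono]

lemma binomial_mem (j : Fin n) : binomial k a j ∈ pcbIdeal k a :=
  Ideal.subset_span ⟨j, rfl⟩

lemma IsPCB.sum_latticeMatrix (ha : IsPCB a) (i : Fin n) : ∑ j, latticeMatrix a i j = 0 := by
  rw [← Finset.add_sum_erase _ _ (Finset.mem_univ i), latticeMatrix_self, ha.diag_eq i,
    Nat.cast_sum, ← Finset.sum_add_distrib]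
  refine Finset.sum_eq_zero fun j hj => ?_
  rw [latticeMatrix_of_ne a (Finset.ne_of_mem_erase hj).symm, add_neg_cancel]

/-! ### Chip firing -/

lemma mono_sub_mem_of_fire {u w : Fin n → ℕ} (j : Fin n) (hu : a j j ≤ u j)
    (h : ∀ i, (w i : ℤ) = u i - latticeMatrix a i j) : mono k u - mono k w ∈ pcbIdeal k a := by
  set c : Fin n → ℕ := fun i => if i = j then u i - a j j else u i with hc
  have h1 : u = c + Pi.single j (a j j) := by
    ext i
    by_cases hij : i = j
    · subst hij; simp [hc, hu]
    · simp [hc, hij]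
  have h2 : w = c + offDiag a j := by
    ext i
    have := h i
    by_cases hij : i = j
    · subst hij
      rw [latticeMatrix_self] at this
      simp only [hc, offDiag, Pi.add_apply, if_true]
      omega
    · rw [latticeMatrix_of_ne a hij] at this
      simp only [hc, offDiag, Pi.add_apply, if_neg hij]
      omega
  rw [h1, h2, mono_add, mono_add, ← mul_sub, ← binomial_eq_mono]
  exact Ideal.mul_mem_left _ _ (binomial_mem j)

lemma sub_mem_trans {R : Type*} [CommRing R] {I : Ideal R} {x y z : R} (h : x - y ∈ I)
    (h' : y - z ∈ I) : x - z ∈ I := by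
  simpa using I.add_mem h h'

/-- The vertices of `T` fire from the largest down: at the turn of `i`, all larger `j ∈ T` have
already given it `a i j` chips. -/
lemma mono_sub_mem_of_fire_decreasing (T : Finset (Fin n)) :
    ∀ {u w : Fin n → ℕ}, (∀ i ∈ T, a i i ≤ u i + ∑ j ∈ T with i < j, a i j) →
      (∀ i, (w i : ℤ) = u i - ∑ j ∈ T, latticeMatrix a i j) →
      mono k u - mono k w ∈ pcbIdeal k a := by
  induction T using Finset.induction_on_max with
  | empty =>
    intro u w _ h
    have : w = u := by ext i; simpa using h i
    simp [this]
  | insert m T hT ih =>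
    intro u w hu h
    have hm : m ∉ T := fun hm => lt_irrefl _ (hT m hm)
    have hum : a m m ≤ u m := by
      have := hu m (Finset.mem_insert_self _ _)
      rwa [Finset.filter_false_of_mem, Finset.sum_empty, add_zero] at this
      intro j hj
      rcases Finset.mem_insert.1 hj with rfl | hj
      · exact lt_irrefl _
      · exact (hT j hj).not_gt
    set v : Fin n → ℕ := fun i => if i = m then u i - a m m else u i + a i m with hv
    have hvu : ∀ i, (v i : ℤ) = u i - latticeMatrix a i m := by
      intro i
      by_cases him : i = m
      · subst him
        simp [hv, hum]
      · simp [hv, him, latticeMatrix_of_ne a him]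
    refine sub_mem_trans (mono_sub_mem_of_fire m hum hvu) (ih ?_ ?_)
    · intro i hi
      have him : i ≠ m := (hT i hi).ne
      have := hu i (Finset.mem_insert_of_mem hi)
      rw [Finset.filter_insert, if_pos (hT i hi), Finset.sum_insert (by simp [hm])] at this
      simp only [hv, if_neg him]
      omega
    · intro i
      rw [h i, hvu i, Finset.sum_insert hm]
      ring

/-- Firing a set undoes firing its complement. -/
lemma IsPCB.sum_compl (ha : IsPCB a) (S : Finset (Fin n)) (i : Fin n) :
    ∑ j ∈ Sᶜ, latticeMatrix a i j = -∑ j ∈ S, latticeMatrix a i j := by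
  rw [eq_neg_iff_add_eq_zero, Finset.sum_compl_add_sum, ha.sum_latticeMatrix]

/-- If `b i` dominates the part of the `i`-th row left of the diagonal, except possibly at one
vertex, then firing a set of vertices is legal after adding `b`. -/
lemma mono_add_sub_mem_of_fire_set (ha : IsPCB a) {b : Fin n → ℕ} {l : Fin n}
    (hb : ∀ i ≠ l, ∑ j ∈ Finset.Iio i, a i j ≤ b i) (S : Finset (Fin n)) {u v : Fin n → ℕ}
    (h : ∀ i, (v i : ℤ) = u i - ∑ j ∈ S, latticeMatrix a i j) :
    mono k (b + u) - mono k (b + v) ∈ pcbIdeal k a := by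
  -- Firing `Sᶜ` leads from `v` back to `u`, so the exceptional vertex can be kept out of the fired
  -- set.
  wlog hl : l ∉ S generalizing S u v
  · have := this Sᶜ (u := v) (v := u) (fun i => by rw [ha.sum_compl, h i]; ring)
      (by simpa using hl)
    rw [← neg_sub]
    exact neg_mem this
  refine mono_sub_mem_of_fire_decreasing S (fun i hi => ?_) fun i => by
    simp only [Pi.add_apply, Nat.cast_add, h i]; ring
  have hil : i ≠ l := fun e => hl (e ▸ hi)
  have h1 := hb i hil
  have h2 := h i
  rw [← Finset.add_sum_erase _ _ hi, latticeMatrix_self,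
    Finset.sum_congr rfl (fun j hj => latticeMatrix_of_ne a (Finset.ne_of_mem_erase hj).symm),
    Finset.sum_neg_distrib, ← Nat.cast_sum] at h2
  -- Since `v i ≥ 0`, `u i` and the gifts from all of `S` cover `a i i`; `b i` replaces the gifts
  -- from smaller vertices, which have not fired yet.
  have h3 : ∑ j ∈ S.erase i, a i j ≤ ∑ j ∈ Finset.Iio i, a i j + ∑ j ∈ S with i < j, a i j := by
    rw [← Finset.sum_union]
    · refine Finset.sum_le_sum_of_subset fun j hj => ?_
      rcases lt_or_gt_of_ne (Finset.ne_of_mem_erase hj) with hlt | hlt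
      · exact Finset.mem_union_left _ (Finset.mem_Iio.2 hlt)
      · exact Finset.mem_union_right _ (Finset.mem_filter.2 ⟨Finset.mem_of_mem_erase hj, hlt⟩)
    · rw [Finset.disjoint_left]
      intro j hj hj'
      exact lt_asymm (Finset.mem_Iio.1 hj) (Finset.mem_filter.1 hj').2
  simp only [Pi.add_apply]
  omega

/-- Firing first the set where `c` takes its top value `N + 1` keeps the configuration nonnegative
and lowers the bound. -/
lemma mono_add_sub_mem_of_bounded (ha : IsPCB a) {b : Fin n → ℕ} {l : Fin n}
    (hb : ∀ i ≠ l, ∑ j ∈ Finset.Iio i, a i j ≤ b i) (N : ℕ) :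
    ∀ {c : Fin n → ℕ} {u v : Fin n → ℕ}, (∀ j, c j ≤ N) →
      (∀ i, (v i : ℤ) = u i - ∑ j, latticeMatrix a i j * c j) →
      mono k (b + u) - mono k (b + v) ∈ pcbIdeal k a := by
  induction N with
  | zero =>
    intro c u v hc h
    have : v = u := by
      ext i
      have hz : ∀ j, c j = 0 := fun j => Nat.le_zero.1 (hc j)
      simpa [hz] using h i
    simp [this]
  | succ N ih =>
    intro c u v hc h
    set S : Finset (Fin n) := {j | c j = N + 1} with hS
    set c' : Fin n → ℕ := fun j => if j ∈ S then N else c j with hc'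
    have hcc : ∀ j, (c j : ℤ) = c' j + if j ∈ S then 1 else 0 := by
      intro j
      by_cases hj : j ∈ S
      · have : c j = N + 1 := by simpa [hS] using hj
        simp [hc', hj, this]
      · simp [hc', hj]
    have hc'N : ∀ j, c' j ≤ N := by
      intro j
      by_cases hj : j ∈ S
      · simp [hc', hj]
      · have h1 : c j ≠ N + 1 := by simpa [hS] using hj
        have h2 := hc j
        simp only [hc', if_neg hj]
        omega
    have hsum : ∀ i, ∑ j, latticeMatrix a i j * (c j : ℤ) =
        ∑ j, latticeMatrix a i j * (c' j : ℤ) + ∑ j ∈ S, latticeMatrix a i j := by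
      intro i
      simp only [hcc, mul_add, Finset.sum_add_distrib, mul_ite, mul_one, mul_zero]
      simp
    have hnonneg : ∀ i, 0 ≤ (u i : ℤ) - ∑ j ∈ S, latticeMatrix a i j := by
      intro i
      by_cases hi : i ∈ S
      -- Zero row sums allow subtracting `N` from `c'`. The diagonal term then vanishes, and the
      -- others are products of two nonpositive factors.
      · have h1 : 0 ≤ ∑ j, latticeMatrix a i j * ((c' j : ℤ) - N) := by
          refine Finset.sum_nonneg fun j _ => ?_
          by_cases hij : i = j
          · subst hij; simp [hc', hi]
          · rw [latticeMatrix_of_ne a hij]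
            have : (c' j : ℤ) ≤ N := by exact_mod_cast hc'N j
            nlinarith [(Nat.cast_nonneg (a i j) : (0 : ℤ) ≤ _)]
        simp only [mul_sub, Finset.sum_sub_distrib, ← Finset.sum_mul, ha.sum_latticeMatrix,
          zero_mul, sub_zero] at h1
        have h2 := h i
        rw [hsum] at h2
        omega
      · have h1 : ∑ j ∈ S, latticeMatrix a i j ≤ 0 := by
          refine Finset.sum_nonpos fun j hj => ?_
          rw [latticeMatrix_of_ne a (by rintro rfl; exact hi hj)]
          simp
        omega
    choose u' hu' using fun i => Int.eq_ofNat_of_zero_le (hnonneg i)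
    refine sub_mem_trans (mono_add_sub_mem_of_fire_set ha hb S (v := u') fun i => (hu' i).symm)
      (ih hc'N fun i => ?_)
    rw [h i, hsum, ← hu' i]
    ring

lemma mono_add_sub_mem_of_mem_range (ha : IsPCB a) {b : Fin n → ℕ} {l : Fin n}
    (hb : ∀ i ≠ l, ∑ j ∈ Finset.Iio i, a i j ≤ b i) {u v : Fin n → ℕ}
    (h : (fun i => (u i : ℤ)) - (fun i => (v i : ℤ)) ∈
      LinearMap.range (latticeMatrix a).mulVecLin) :
    mono k (b + u) - mono k (b + v) ∈ pcbIdeal k a := by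
  obtain ⟨c, hc⟩ := h
  set K : ℕ := ∑ j, (c j).natAbs with hK
  have hcK : ∀ j, (c j).natAbs ≤ K := fun j =>
    Finset.single_le_sum (f := fun j => (c j).natAbs) (fun _ _ => Nat.zero_le _)
      (Finset.mem_univ j)
  -- Adding a constant to `c` makes it nonnegative and does not change its image.
  choose d hd using fun j => Int.eq_ofNat_of_zero_le (show 0 ≤ c j + K by have := hcK j; omega)
  refine mono_add_sub_mem_of_bounded ha hb (2 * K) (c := d) (fun j => ?_) fun i => ?_
  · have := hcK j
    have := hd j
    omega
  · have h1 := congrFun hc i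
    simp only [Matrix.mulVecLin_apply, Matrix.mulVec, dotProduct, Pi.sub_apply] at h1
    have h2 : ∑ j, latticeMatrix a i j * (d j : ℤ) = ∑ j, latticeMatrix a i j * c j := by
      simp only [← Int.ofNat_eq_natCast, ← hd, mul_add, Finset.sum_add_distrib, ← Finset.sum_mul,
        ha.sum_latticeMatrix, zero_mul, add_zero]
    rw [h2, h1]
    ring

/-! ### The lattice algebra -/

/-- The quotient of `ℤⁿ` by the lattice spanned by the exponents of the critical binomials. -/
abbrev LatticeQuotient (a : Matrix (Fin n) (Fin n) ℕ) : Type :=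
  (Fin n → ℤ) ⧸ LinearMap.range (latticeMatrix a).mulVecLin

/-- The class of an exponent vector modulo the lattice. -/
def latticeClass (a : Matrix (Fin n) (Fin n) ℕ) (u : Fin n → ℤ) : LatticeQuotient a :=
  Submodule.Quotient.mk u

/-- The map from the polynomial ring to the group algebra of `ℤⁿ` modulo the lattice. -/
def toLatticeAlgebra (k : Type*) [CommRing k] (a : Matrix (Fin n) (Fin n) ℕ) :
    MvPolynomial (Fin n) k →ₐ[k] AddMonoidAlgebra k (LatticeQuotient a) :=
  aeval fun i => AddMonoidAlgebra.single (latticeClass a (Pi.single i 1)) 1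

lemma toLatticeAlgebra_mono (u : Fin n → ℕ) :
    toLatticeAlgebra k a (mono k u) =
      AddMonoidAlgebra.single (latticeClass a fun i => (u i : ℤ)) 1 := by
  have h : ∀ s : Finset (Fin n), ∏ i ∈ s, AddMonoidAlgebra.single
      (latticeClass a (Pi.single i 1)) (1 : k) ^ u i =
      AddMonoidAlgebra.single (∑ i ∈ s, u i • latticeClass a (Pi.single i 1)) 1 := by
    intro s
    induction s using Finset.induction_on with
    | empty => simp [AddMonoidAlgebra.one_def]
    | insert i s hi ih =>
      rw [Finset.prod_insert hi, Finset.sum_insert hi, ih, AddMonoidAlgebra.single_pow,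
        AddMonoidAlgebra.single_mul_single, one_pow, one_mul]
  simp only [toLatticeAlgebra, mono, map_prod, map_pow, aeval_X]
  rw [h]
  congr 1
  simp only [latticeClass, ← Submodule.Quotient.mk_smul]
  rw [← Submodule.mkQ_apply]
  simp only [← Submodule.mkQ_apply, ← map_sum]
  congr 1
  ext i
  simp [Finset.sum_apply, Pi.single_apply]

lemma toLatticeAlgebra_eq_zero_of_mem {f : MvPolynomial (Fin n) k} (hf : f ∈ pcbIdeal k a) :
    toLatticeAlgebra k a f = 0 := by
  have : pcbIdeal k a ≤ RingHom.ker (toLatticeAlgebra k a) := by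
    rw [pcbIdeal, Ideal.span_le]
    rintro _ ⟨j, rfl⟩
    rw [SetLike.mem_coe, RingHom.mem_ker, binomial_eq_mono, map_sub, toLatticeAlgebra_mono,
      toLatticeAlgebra_mono, sub_eq_zero]
    congr 1
    refine (Submodule.Quotient.eq _).2 ⟨Pi.single j 1, ?_⟩
    ext i
    by_cases hij : i = j
    · subst hij; simp [offDiag]
    · simp [offDiag, hij, latticeMatrix_of_ne a hij]
  exact this hf

/-- Multiplication by `x^b` into `A/I` factors through the lattice algebra, because modulo `I` the
product `x^b x^u` depends only on the class of `u`. -/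
lemma mul_mono_mem_of_toLatticeAlgebra_eq_zero (ha : IsPCB a) {b : Fin n → ℕ} {l : Fin n}
    (hb : ∀ i ≠ l, ∑ j ∈ Finset.Iio i, a i j ≤ b i) {f : MvPolynomial (Fin n) k}
    (hf : toLatticeAlgebra k a f = 0) : f * mono k b ∈ pcbIdeal k a := by
  classical
  -- The default `0` is for classes without a nonnegative representative; these contain no exponent
  -- of a monomial.
  let r : LatticeQuotient a → (Fin n → ℕ) := fun g =>
    if h : ∃ u : Fin n → ℕ, latticeClass a (fun i => (u i : ℤ)) = g then h.choose else 0
  have hr : ∀ u : Fin n → ℕ,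
      latticeClass a (fun i => (r (latticeClass a fun i => (u i : ℤ)) i : ℤ)) =
        latticeClass a fun i => (u i : ℤ) := by
    intro u
    have h : ∃ v : Fin n → ℕ, latticeClass a (fun i => (v i : ℤ)) =
      latticeClass a fun i => (u i : ℤ) := ⟨u, rfl⟩
    simp only [r, dif_pos h]
    exact h.choose_spec
  -- a linear lift through representatives of the classes
  let ψ : AddMonoidAlgebra k (LatticeQuotient a) → MvPolynomial (Fin n) k ⧸ pcbIdeal k a :=
    fun x => x.coeff.sum fun g t => t • Ideal.Quotient.mk (pcbIdeal k a) (mono k (b + r g))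
  have hψ : ∀ x y, ψ (x + y) = ψ x + ψ y := by
    intro x y
    simp only [ψ]
    rw [AddMonoidAlgebra.coeff_add, Finsupp.sum_add_index'] <;> simp [add_smul]
  have key : ∀ p : MvPolynomial (Fin n) k,
      ψ (toLatticeAlgebra k a p) = Ideal.Quotient.mk (pcbIdeal k a) (p * mono k b) := by
    intro p
    induction p using MvPolynomial.induction_on' with
    | monomial u t =>
      have e : monomial u t = t • mono k (u : Fin n → ℕ) := by
        rw [mono_eq_monomial, smul_monomial, smul_eq_mul, mul_one]
        congr 1
        ext; simp
      rw [e, map_smul, toLatticeAlgebra_mono]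
      simp only [ψ]
      rw [AddMonoidAlgebra.smul_single, AddMonoidAlgebra.coeff_single,
        Finsupp.sum_single_index (by simp), smul_eq_mul, mul_one, smul_mul_assoc, ← mono_add,
        add_comm (u : Fin n → ℕ) b, ← Ideal.Quotient.mkₐ_eq_mk k,
        map_smul]
      congr 1
      rw [Ideal.Quotient.mkₐ_eq_mk, Ideal.Quotient.eq]
      exact mono_add_sub_mem_of_mem_range ha hb ((Submodule.Quotient.eq _).1 (hr _))
    | add p q hp hq => rw [map_add, hψ, hp, hq, add_mul, map_add]
  have := key f
  rw [hf] at this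
  rw [← Ideal.Quotient.eq_zero_iff_mem, ← this]
  simp [ψ]

/-! ### Saturated colon ideals and the exponent `b(n)`. -/

lemma colon_eq_saturation (ha : IsPCB a) {b : Fin n → ℕ} {l : Fin n}
    (hb : ∀ i ≠ l, ∑ j ∈ Finset.Iio i, a i j ≤ b i) :
    (pcbIdeal k a).colon {mono k b} = saturation (pcbIdeal k a) (mono k b) := by
  ext f
  rw [Submodule.mem_colon_singleton, smul_eq_mul]
  refine ⟨fun h => ⟨1, by rwa [pow_one]⟩, ?_⟩
  rintro ⟨N, hN⟩
  refine mul_mono_mem_of_toLatticeAlgebra_eq_zero ha hb ?_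
  have h1 := toLatticeAlgebra_eq_zero_of_mem hN
  rw [map_mul, map_pow, toLatticeAlgebra_mono, AddMonoidAlgebra.single_pow, one_pow] at h1
  -- The image of `x^b` is a unit, so its `N`-th power cancels.
  have h2 := congrArg (· * AddMonoidAlgebra.single
    (-(N • latticeClass a fun i => (b i : ℤ))) (1 : k)) h1
  simpa [mul_assoc, AddMonoidAlgebra.single_mul_single, ← AddMonoidAlgebra.one_def] using h2

/-- `diag_eq` leaves exactly the entries left of the diagonal; at the first vertex there are none,
and the last serves as the exceptional vertex. -/
lemma IsPCB.sum_Iio_le_lastExponent (ha : IsPCB a) {i : Fin n} (hi : (i : ℕ) + 1 ≠ n) :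
    ∑ j ∈ Finset.Iio i, a i j ≤ lastExponent a i := by
  by_cases h0 : (i : ℕ) = 0
  · rw [Finset.sum_eq_zero]
    · exact Nat.zero_le _
    · intro j hj
      have : j < i := Finset.mem_Iio.1 hj
      rw [Fin.lt_def] at this
      omega
  · rw [lastExponent, if_neg (by tauto), ha.diag_eq i]
    refine Nat.le_sub_of_add_le ?_
    rw [← Finset.sum_union]
    · refine Finset.sum_le_sum_of_subset fun j hj => ?_
      rw [Finset.mem_union, Finset.mem_Iio, Finset.mem_Ioi] at hj
      exact Finset.mem_erase.2 ⟨by rcases hj with h | h; exacts [h.ne, h.ne'], Finset.mem_univ _⟩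
    · rw [Finset.disjoint_left]
      intro j hj hj'
      exact lt_asymm (Finset.mem_Iio.1 hj) (Finset.mem_Ioi.1 hj')

lemma IsPCB.lastExponent_ne_zero (ha : IsPCB a) (hn : 3 ≤ n) : lastExponent a ≠ 0 := by
  intro h
  have h1 := ha.sum_Iio_le_lastExponent (i := ⟨1, by omega⟩) (by simp; omega)
  rw [h, Pi.zero_apply] at h1
  have h2 : a ⟨1, by omega⟩ ⟨0, by omega⟩ ≤
      ∑ j ∈ Finset.Iio (⟨1, by omega⟩ : Fin n), a ⟨1, by omega⟩ j :=
    Finset.single_le_sum (fun _ _ => Nat.zero_le _) (Finset.mem_Iio.2 (by simp))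
  have := ha.pos ⟨1, by omega⟩ ⟨0, by omega⟩
  omega

end Ring
/-! ### Primary decompositions -/

/-- A minimal primary decomposition of `S` extends by an irredundant component `Q` whose radical
contains an element regular modulo `S`. -/
lemma exists_isMinimalPrimaryDecomposition_of_inf {R : Type*} [CommRing R] [IsNoetherianRing R]
    {I S Q : Ideal R} (hI : I = S ⊓ Q) (hne : I ≠ S) (hQ : Q.IsPrimary) {g : R}
    (hg : g ∈ Q.radical) (hS : ∀ f, f * g ∈ S → f ∈ S) :
    ∃ t : Finset (Ideal R), Submodule.IsMinimalPrimaryDecomposition I t ∧ Q ∈ t := by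
  classical
  have hSpow : ∀ N f, f * g ^ N ∈ S → f ∈ S := by
    intro N
    induction N with
    | zero => intro f hf; simpa using hf
    | succ N ih => intro f hf; exact ih f (hS _ (by rwa [pow_succ, ← mul_assoc] at hf))
  obtain ⟨t, ht⟩ :=
    Submodule.IsLasker.exists_isMinimalPrimaryDecomposition (Submodule.isLasker R R) S
  have hSinf : ∀ f, f ∈ S ↔ ∀ q ∈ t, f ∈ q := fun f => by
    rw [← ht.inf_eq, Submodule.mem_finsetInf]; rfl
  -- A component `q` containing a power of `g` would be redundant: an `f` in all the others has `f *
  -- g ^ N ∈ S`, so `f ∈ S`.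
  have hgq : ∀ q ∈ t, g ∉ Ideal.radical q := by
    rintro q hq ⟨N, hN⟩
    refine ht.minimal hq fun f hf => ?_
    rw [Submodule.mem_finsetInf] at hf
    refine (hSinf f).1 (hSpow N f ((hSinf _).2 fun q' hq' => ?_)) q hq
    by_cases h : q' = q
    · exact h ▸ Ideal.mul_mem_left q f hN
    · exact Ideal.mul_mem_right _ q' (hf q' (Finset.mem_erase.2 ⟨h, hq'⟩))
  have hQt : Q ∉ t := fun h => hgq Q h hg
  refine ⟨insert Q t, ⟨?_, ?_, ?_, ?_⟩, Finset.mem_insert_self _ _⟩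
  · rw [Finset.inf_insert, ht.inf_eq, hI, inf_comm]; rfl
  · intro J hJ
    rcases Finset.mem_insert.1 hJ with rfl | hJ
    · exact hQ
    · exact ht.primary hJ
  · rw [Finset.coe_insert]
    refine ht.distinct.insert fun q hq _ => ?_
    simp only [Function.onFun, Submodule.colon_univ]
    exact ⟨fun e => hgq q hq (e ▸ hg), fun e => hgq q hq (e ▸ hg)⟩
  · intro J hJ hle
    rcases Finset.mem_insert.1 hJ with rfl | hJ
    · rw [Finset.erase_insert hQt, ht.inf_eq] at hle
      exact hne (hI.trans (inf_eq_left.2 hle))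
    · refine ht.minimal hJ fun f hf => ?_
      rw [Submodule.mem_finsetInf] at hf
      obtain ⟨N, hN⟩ := hg
      have h1 : f * g ^ N ∈ J := by
        refine hle ((Submodule.mem_finsetInf).2 fun q hq => ?_)
        obtain ⟨hqJ, hq⟩ := Finset.mem_erase.1 hq
        rcases Finset.mem_insert.1 hq with rfl | hq
        · exact Ideal.mul_mem_left _ f hN
        · exact Ideal.mul_mem_right _ q (hf q (Finset.mem_erase.2 ⟨hqJ, hq⟩))
      refine ((Ideal.isPrimary_iff.1 (ht.primary hJ)).2 h1).resolve_right fun h => hgq J hJ ?_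
      exact Ideal.mem_radical_of_pow_mem h

/-! ### The Laurent contraction -/

section CommRing

variable {k : Type*} [CommRing k] {a : Matrix (Fin n) (Fin n) ℕ}

lemma mem_laurentContraction {I : Ideal (MvPolynomial (Fin n) k)} {f : MvPolynomial (Fin n) k} :
    f ∈ laurentContraction I ↔ ∃ N : ℕ, f * (∏ i, X i) ^ N ∈ I := by
  rw [laurentContraction, Ideal.mem_comap, IsLocalization.algebraMap_mem_map_algebraMap_iff
    (Submonoid.powers (∏ i, X i : MvPolynomial (Fin n) k))]
  constructor
  · rintro ⟨_, ⟨N, rfl⟩, h⟩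
    exact ⟨N, by rwa [mul_comm]⟩
  · rintro ⟨N, h⟩
    exact ⟨_, ⟨N, rfl⟩, by rwa [mul_comm]⟩

/-- The second monomial of `f_j` contains every variable but `x_j`, so `x_j` times it is divisible
by `x₁ ⋯ xₙ`. -/
lemma IsPCB.exists_pow_sub_mem (ha : IsPCB a) (j : Fin n) :
    ∃ c, (X j : MvPolynomial (Fin n) k) ^ (a j j + 1) - (∏ i, X i) * c ∈ pcbIdeal k a := by
  have h : ∃ c, X j * mono k (offDiag a j) = (∏ i, X i) * c := by
    have e : (∏ i, X i : MvPolynomial (Fin n) k) = mono k 1 := by simp [mono]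
    rw [e, ← pow_one (X j), ← mono_single, ← mono_add]
    refine ⟨mono k ((Pi.single j 1 + offDiag a j) - 1), ?_⟩
    rw [← mono_add, add_tsub_cancel_of_le]
    intro i
    by_cases hij : i = j
    · subst hij; simp
    · simpa [offDiag, hij] using Nat.one_le_iff_ne_zero.2 (ha.pos i j).ne'
  obtain ⟨c, hc⟩ := h
  refine ⟨c, ?_⟩
  rw [← hc, pow_succ', ← mono_single, ← mul_sub, ← binomial_eq_mono]
  exact Ideal.mul_mem_left _ _ (binomial_mem j)

lemma mul_pow_mem_of_dvd {R : Type*} [CommRing R] {I : Ideal R} {f x y c : R}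
    (h : y - x * c ∈ I) {N : ℕ} (hf : f * x ^ N ∈ I) : f * y ^ N ∈ I := by
  have h1 : y ^ N - (x * c) ^ N ∈ I := I.mem_of_dvd (sub_dvd_pow_sub_pow _ _ N) h
  have h2 := I.add_mem (I.mul_mem_left f h1) (I.mul_mem_right (c ^ N) hf)
  convert h2 using 1
  ring

lemma IsPCB.exists_mul_X_pow_mem (ha : IsPCB a) {f : MvPolynomial (Fin n) k}
    (hf : f ∈ laurentContraction (pcbIdeal k a)) (j : Fin n) :
    ∃ N, f * X j ^ N ∈ pcbIdeal k a := by
  obtain ⟨N, hN⟩ := mem_laurentContraction.1 hf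
  obtain ⟨c, hc⟩ := ha.exists_pow_sub_mem (k := k) j
  exact ⟨_, by rw [pow_mul]; exact mul_pow_mem_of_dvd hc hN⟩

lemma mono_dvd_prod_X_pow (α : Fin n → ℕ) :
    mono k α ∣ (∏ i, X i) ^ ∑ i, α i := by
  rw [← Finset.prod_pow]
  exact Finset.prod_dvd_prod_of_dvd _ _ fun i _ => pow_dvd_pow _
    (Finset.single_le_sum (fun _ _ => Nat.zero_le _) (Finset.mem_univ i))

lemma mem_laurentContraction_of_mul_mono_mem {I : Ideal (MvPolynomial (Fin n) k)}
    {f : MvPolynomial (Fin n) k} {α : Fin n → ℕ} {N : ℕ} (h : f * mono k α ^ N ∈ I) :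
    f ∈ laurentContraction I := by
  refine mem_laurentContraction.2 ⟨(∑ i, α i) * N, I.mem_of_dvd ?_ h⟩
  rw [pow_mul]
  exact mul_dvd_mul_left f (pow_dvd_pow_of_dvd (mono_dvd_prod_X_pow α) N)

lemma IsPCB.saturation_eq (ha : IsPCB a) {α : Fin n → ℕ} (hα : α ≠ 0) :
    saturation (pcbIdeal k a) (mono k α) = laurentContraction (pcbIdeal k a) := by
  ext f
  refine ⟨fun ⟨N, hN⟩ => mem_laurentContraction_of_mul_mono_mem hN, fun hf => ?_⟩
  obtain ⟨j, hj⟩ := Function.ne_iff.1 hα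
  obtain ⟨N, hN⟩ := ha.exists_mul_X_pow_mem hf j
  exact ⟨N, Ideal.mem_of_dvd _ (mul_dvd_mul_left f (pow_dvd_pow_of_dvd (X_dvd_mono hj) N)) hN⟩

lemma mem_laurentContraction_of_mul_X_mem {I : Ideal (MvPolynomial (Fin n) k)}
    {f : MvPolynomial (Fin n) k} {j : Fin n} (h : f * X j ∈ laurentContraction I) :
    f ∈ laurentContraction I := by
  obtain ⟨N, hN⟩ := mem_laurentContraction.1 h
  refine mem_laurentContraction.2 ⟨N + 1, I.mem_of_dvd ?_ hN⟩
  rw [pow_succ', mul_assoc]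
  exact mul_dvd_mul_left f (mul_dvd_mul_right (Finset.dvd_prod_of_mem _ (Finset.mem_univ j)) _)

/-! ### Failure of saturation -/

/-- `I` lies in the monomial ideal generated by both terms of every `f_j`. -/
lemma mono_mem_of_mem_pcbIdeal_coeff_ne_zero {f : MvPolynomial (Fin n) k}
    (hf : f ∈ pcbIdeal k a) {u : Fin n →₀ ℕ} (hu : coeff u f ≠ 0) :
    ∃ j, a j j ≤ u j ∨ ∀ i ≠ j, a i j ≤ u i := by
  have hle : pcbIdeal k a ≤ Ideal.span ((fun s => monomial s (1 : k)) ''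
      {s : Fin n →₀ ℕ | ∃ j, (s : Fin n → ℕ) = Pi.single j (a j j) ∨
        (s : Fin n → ℕ) = offDiag a j}) := by
    rw [pcbIdeal, Ideal.span_le]
    rintro _ ⟨j, rfl⟩
    rw [SetLike.mem_coe, binomial_eq_mono, mono_eq_monomial, mono_eq_monomial]
    exact sub_mem (Ideal.subset_span ⟨_, ⟨j, Or.inl rfl⟩, rfl⟩)
      (Ideal.subset_span ⟨_, ⟨j, Or.inr rfl⟩, rfl⟩)
  obtain ⟨s, ⟨j, hj⟩, hs⟩ := mem_ideal_span_monomial_image.1 (hle hf) u (mem_support_iff.2 hu)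
  refine ⟨j, hj.imp (fun h => ?_) fun h i hi => ?_⟩
  · simpa [h] using hs j
  · simpa [h, offDiag, hi] using hs i

lemma IsPCB.pcbIdeal_ne_laurentContraction [Nontrivial k] (ha : IsPCB a) (hn : 4 ≤ n) :
    pcbIdeal k a ≠ laurentContraction (pcbIdeal k a) := by
  intro hsat
  set p : Fin n := ⟨0, by omega⟩ with hp
  set q : Fin n := ⟨1, by omega⟩ with hq
  have hpq : p ≠ q := by simp [hp, hq]
  have hdom : ∀ i j l, i ≠ j → i ≠ l → j ≠ l → a i j + a i l ≤ a i i := by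
    intro i j l hij hil hjl
    rw [ha.diag_eq i, ← Finset.sum_pair hjl]
    refine Finset.sum_le_sum_of_subset fun x hx => ?_
    rcases Finset.mem_insert.1 hx with rfl | hx
    · simp [hij.symm]
    · simp [Finset.mem_singleton.1 hx, hil.symm]
  set r : Fin n := ⟨2, by omega⟩ with hr
  have hpr : p ≠ r := by simp [hp, hr]
  have hqr : q ≠ r := by simp [hq, hr]
  have h1 := hdom p q r hpq hpr hqr
  have h2 := hdom q p r hpq.symm hqr hpr
  have h3 := ha.pos p r
  have h4 := ha.pos p q
  have h5 := ha.pos q p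
  -- Firing `p` and then `q` turns `x_p ^ a p p * x_q ^ a q q` into another monomial; `u` and `v`
  -- remain after the common factor `x_p ^ a p q * x_q ^ a q p` is cancelled.
  set u : Fin n → ℕ := fun i => if i = p then a p p - a p q else if i = q then a q q - a q p else 0
    with hu
  set v : Fin n → ℕ := fun i => if i = p then 0 else if i = q then 0 else a i p + a i q with hv
  have hmem : mono k u - mono k v ∈ laurentContraction (pcbIdeal k a) := by
    set w : Fin n → ℕ := Pi.single p (a p q) + Pi.single q (a q p) with hw
    refine mem_laurentContraction_of_mul_mono_mem (α := w) (N := 1) ?_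
    rw [pow_one, sub_mul, ← mono_add, ← mono_add]
    refine sub_mem_trans (y := mono k (Pi.single q (a q q) + offDiag a p))
      (mono_sub_mem_of_fire p ?_ fun i => ?_) (mono_sub_mem_of_fire q ?_ fun i => ?_)
    · simp only [hu, hw, Pi.add_apply, if_true, Pi.single_eq_same]
      omega
    · by_cases hip : i = p
      · subst hip
        simp [hu, hw, offDiag, hpq]
        omega
      · rw [latticeMatrix_of_ne a hip]
        by_cases hiq : i = q
        · rw [hiq]
          simp [hu, hw, offDiag, hpq.symm]
          omega
        · simp [hu, hw, offDiag, hip, hiq]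
    · simp
    · by_cases hiq : i = q
      · subst hiq
        simp [hv, hw, offDiag, hpq.symm]
      · rw [latticeMatrix_of_ne a hiq]
        by_cases hip : i = p
        · rw [hip]
          simp [hv, hw, offDiag, hpq]
        · simp [hv, hw, offDiag, hip, hiq]
  rw [← hsat] at hmem
  have huv : Finsupp.equivFunOnFinite.symm v ≠ Finsupp.equivFunOnFinite.symm u := by
    intro e
    have := congrFun (Finsupp.equivFunOnFinite.symm.injective e) p
    simp [hu, hv] at this
    omega
  have hcoeff : coeff (Finsupp.equivFunOnFinite.symm u) (mono k u - mono k v) ≠ 0 := by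
    rw [mono_eq_monomial, mono_eq_monomial, coeff_sub, coeff_monomial, coeff_monomial, if_pos rfl,
      if_neg huv]
    simp
  obtain ⟨j, hj⟩ := mono_mem_of_mem_pcbIdeal_coeff_ne_zero hmem hcoeff
  simp only [Finsupp.equivFunOnFinite_symm_apply_apply] at hj
  rcases hj with hj | hj
  · have hpos := ha.pos j j
    by_cases hjp : j = p
    · rw [hjp] at hj; simp [hu] at hj; omega
    · by_cases hjq : j = q
      · rw [hjq] at hj; simp [hu, hpq.symm] at hj; omega
      · simp [hu, hjp, hjq] at hj; omega
  -- For `n ≥ 4` the second monomial of `f_j` involves at least three variables, but `x^u` only two.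
  · obtain ⟨i, hij, hip, hiq⟩ : ∃ i : Fin n, i ≠ j ∧ i ≠ p ∧ i ≠ q := by
      by_cases h : j = r
      · exact ⟨⟨3, by omega⟩, by simp [h, hr], by simp [hp], by simp [hq]⟩
      · exact ⟨r, Ne.symm h, hpr.symm, hqr.symm⟩
    have h6 := hj i hij
    have h7 := ha.pos i j
    simp [hu, hip, hiq] at h6
    omega

/-! ### A positive grading -/

/-- The matrix is singular, so it has a nonzero left kernel vector. Its absolute values satisfy the
column relations as inequalities, and summing over the columns forces equality. A zero weight would
then make all weights zero. -/
lemma IsPCB.exists_pos_weight (ha : IsPCB a) (hn : 0 < n) :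
    ∃ d : Fin n → ℕ, (∀ i, 0 < d i) ∧
      ∀ j, d j * a j j = ∑ i ∈ Finset.univ.erase j, d i * a i j := by
  have hdet : (latticeMatrix a).det = 0 := by
    refine Matrix.exists_mulVec_eq_zero_iff.1 ⟨1, fun h => ?_, ?_⟩
    · simpa using congrFun h ⟨0, hn⟩
    · ext i
      simp [Matrix.mulVec, dotProduct, ha.sum_latticeMatrix]
  obtain ⟨c, hc0, hc⟩ := Matrix.exists_vecMul_eq_zero_iff.2 hdet
  have hcj : ∀ j, c j * a j j = ∑ i ∈ Finset.univ.erase j, c i * a i j := by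
    intro j
    have := congrFun hc j
    simp only [Matrix.vecMul, dotProduct, Pi.zero_apply] at this
    rw [← Finset.add_sum_erase _ _ (Finset.mem_univ j), latticeMatrix_self,
      Finset.sum_congr rfl fun i hi => by
        rw [latticeMatrix_of_ne a (Finset.ne_of_mem_erase hi), mul_neg],
      Finset.sum_neg_distrib, ← sub_eq_add_neg, sub_eq_zero] at this
    exact this
  set d : Fin n → ℕ := fun i => (c i).natAbs with hd
  have hle : ∀ j ∈ Finset.univ, d j * a j j ≤ ∑ i ∈ Finset.univ.erase j, d i * a i j := by
    intro j _
    have h1 : (d j * a j j : ℤ) = |c j * a j j| := by simp [hd, abs_mul]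
    zify
    rw [h1, hcj]
    refine (Finset.abs_sum_le_sum_abs _ _).trans (le_of_eq ?_)
    exact Finset.sum_congr rfl fun i _ => by simp [hd, abs_mul]
  have hsum : ∑ j, d j * a j j = ∑ j, ∑ i ∈ Finset.univ.erase j, d i * a i j := by
    rw [Finset.sum_comm' (t' := Finset.univ) (s' := fun i => Finset.univ.erase i)
      (by simp [eq_comm])]
    exact Finset.sum_congr rfl fun i _ => by rw [← Finset.mul_sum, ← ha.diag_eq]
  have heq : ∀ j, d j * a j j = ∑ i ∈ Finset.univ.erase j, d i * a i j := fun j =>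
    (Finset.sum_eq_sum_iff_of_le hle).1 hsum j (Finset.mem_univ j)
  refine ⟨d, fun j => Nat.pos_of_ne_zero fun hj => hc0 ?_, heq⟩
  have h0 := heq j
  rw [hj, zero_mul, eq_comm, Finset.sum_eq_zero_iff] at h0
  ext i
  by_cases hij : i = j
  · subst hij; exact Int.natAbs_eq_zero.1 hj
  · have := h0 i (Finset.mem_erase.2 ⟨hij, Finset.mem_univ i⟩)
    exact Int.natAbs_eq_zero.1 ((Nat.mul_eq_zero.1 this).resolve_right (ha.pos i j).ne')

lemma irrelevant_eq_ker : irrelevant k n = RingHom.ker (constantCoeff (σ := Fin n) (R := k)) := by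
  ext f
  rw [irrelevant, ← Set.image_univ, mem_ideal_span_X_image, RingHom.mem_ker, constantCoeff_eq]
  constructor
  · intro h
    by_contra h0
    obtain ⟨i, _, hi⟩ := h 0 (mem_support_iff.2 h0)
    exact hi rfl
  · intro h m hm
    by_contra! hm0
    have : m = 0 := by ext i; exact hm0 i (Set.mem_univ i)
    exact mem_support_iff.1 hm (this ▸ h)

lemma X_mem_irrelevant (i : Fin n) : (X i : MvPolynomial (Fin n) k) ∈ irrelevant k n :=
  Ideal.subset_span ⟨i, rfl⟩

/-- The weights define a monomial curve `x_i ↦ t ^ d i`, whose ideal is a prime containing `I` and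
strictly inside `𝔪`. -/
lemma irrelevant_notMem_minimalPrimes [IsDomain k] (ha : IsPCB a) (hn : 2 ≤ n) :
    irrelevant k n ∉ (pcbIdeal k a).minimalPrimes := by
  obtain ⟨d, hd, hda⟩ := ha.exists_pos_weight (by omega)
  intro hmin
  let φ : MvPolynomial (Fin n) k →ₐ[k] Polynomial k := aeval fun i => Polynomial.X ^ d i
  have hI : pcbIdeal k a ≤ RingHom.ker φ := by
    rw [pcbIdeal, Ideal.span_le]
    rintro _ ⟨j, rfl⟩
    rw [SetLike.mem_coe, RingHom.mem_ker, binomial]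
    simp only [φ, map_sub, map_pow, map_prod, aeval_X, ← pow_mul, Finset.prod_pow_eq_pow_sum]
    rw [hda j, sub_self]
  have hm : RingHom.ker φ ≤ irrelevant k n := by
    intro f hf
    rw [irrelevant_eq_ker, RingHom.mem_ker]
    have h1 : ((Polynomial.aeval (0 : k)).comp φ) f = 0 := by
      rw [AlgHom.comp_apply, (RingHom.mem_ker).1 hf, map_zero]
    have h2 : (Polynomial.aeval (0 : k)).comp φ = aeval (fun _ => (0 : k)) := by
      ext i
      simp [φ, (hd i).ne']
    rw [h2] at h1
    simpa [constantCoeff_eq, aeval_zero'] using h1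
  have hle := hmin.2 ⟨RingHom.ker_isPrime φ, hI⟩ hm
  have := (RingHom.mem_ker).1 (hle (X_mem_irrelevant ⟨0, by omega⟩))
  simp [φ] at this

end CommRing

/-! ### The `𝔪`-primary component. -/

section Field

variable {k : Type*} [Field k] {a : Matrix (Fin n) (Fin n) ℕ}

instance irrelevant_isMaximal : (irrelevant k n).IsMaximal := by
  rw [irrelevant_eq_ker]
  exact RingHom.ker_isMaximal_of_surjective _ fun c => ⟨C c, constantCoeff_C _ c⟩

lemma IsPCB.pcbIdeal_le_irrelevant (ha : IsPCB a) (hn : 2 ≤ n) :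
    pcbIdeal k a ≤ irrelevant k n := by
  rw [pcbIdeal, Ideal.span_le]
  rintro _ ⟨j, rfl⟩
  refine sub_mem (Ideal.pow_mem_of_mem _ (X_mem_irrelevant j) _ (ha.pos j j)) ?_
  obtain ⟨i, hi⟩ : ∃ i : Fin n, i ≠ j := by
    have : Nontrivial (Fin n) := Fin.nontrivial_iff_two_le.2 hn
    exact exists_ne j
  exact Ideal.mem_of_dvd _ (Finset.dvd_prod_of_mem _ (Finset.mem_erase.2 ⟨hi, Finset.mem_univ i⟩))
    (Ideal.pow_mem_of_mem _ (X_mem_irrelevant i) _ (ha.pos i j))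

lemma IsPCB.radical_sup_span_mono (ha : IsPCB a) (hn : 2 ≤ n) {α : Fin n → ℕ} (hα : α ≠ 0) :
    (pcbIdeal k a ⊔ Ideal.span {mono k α}).radical = irrelevant k n := by
  refine le_antisymm ?_ ?_
  · rw [Ideal.IsRadical.radical_le_iff (irrelevant_isMaximal.isPrime.isRadical), sup_le_iff,
      Ideal.span_singleton_le_iff_mem]
    obtain ⟨j, hj⟩ := Function.ne_iff.1 hα
    exact ⟨ha.pcbIdeal_le_irrelevant hn, Ideal.mem_of_dvd _ (X_dvd_mono hj) (X_mem_irrelevant j)⟩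
  · rw [irrelevant, Ideal.span_le]
    rintro _ ⟨j, rfl⟩
    obtain ⟨c, hc⟩ := ha.exists_pow_sub_mem (k := k) j
    set Q := pcbIdeal k a ⊔ Ideal.span {mono k α}
    have h1 : (1 : MvPolynomial (Fin n) k) * (∏ i, X i) ^ ∑ i, α i ∈ Q := by
      rw [one_mul]
      exact Q.mem_of_dvd (mono_dvd_prod_X_pow α)
        (Ideal.mem_sup_right (Ideal.mem_span_singleton_self _))
    have h2 := mul_pow_mem_of_dvd (show _ ∈ Q from Ideal.mem_sup_left hc) h1
    rw [one_mul, ← pow_mul] at h2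
    exact ⟨_, h2⟩

/-- Every `f_j` vanishes at `(1, …, 1)`, and no monomial does. -/
lemma mono_notMem_pcbIdeal (α : Fin n → ℕ) : mono k α ∉ pcbIdeal k a := by
  intro h
  have hle : pcbIdeal k a ≤ RingHom.ker (aeval (R := k) fun _ : Fin n => (1 : k)) := by
    rw [pcbIdeal, Ideal.span_le]
    rintro _ ⟨j, rfl⟩
    simp [RingHom.mem_ker, binomial]
  have := (RingHom.mem_ker).1 (hle h)
  simp [mono] at this

/-- If `x + c * g ∈ S` with `x ∈ I`, then `c * g ∈ S`, so `c ∈ S = I : g` and `c * g ∈ I`. -/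
lemma eq_inf_sup_span_of_colon_eq {R : Type*} [CommRing R] {I S : Ideal R} {g : R} (hIS : I ≤ S)
    (h : ∀ f, f * g ∈ S → f ∈ S) (hS : I.colon {g} = S) : I = S ⊓ (I ⊔ Ideal.span {g}) := by
  refine le_antisymm (le_inf hIS le_sup_left) ?_
  rintro f ⟨hfS, hf⟩
  obtain ⟨x, hx, _, hy, rfl⟩ := Submodule.mem_sup.1 hf
  obtain ⟨c, rfl⟩ := Ideal.mem_span_singleton'.1 hy
  have h1 : c * g ∈ S := by simpa using S.sub_mem hfS (hIS hx)
  have h2 := h c h1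
  rw [← hS, Submodule.mem_colon_singleton] at h2
  exact I.add_mem hx h2

theorem IsPCB.isEmbeddedComponent_and_isIrredundantInter (ha : IsPCB a) (hn : 4 ≤ n)
    {α : Fin n → ℕ} (hα : α ≠ 0)
    (h : (pcbIdeal k a).colon {mono k α} = saturation (pcbIdeal k a) (mono k α)) :
    IsEmbeddedComponent (pcbIdeal k a) (irrelevant k n)
        (pcbIdeal k a ⊔ Ideal.span {mono k α}) ∧
      IsIrredundantInter (pcbIdeal k a) (laurentContraction (pcbIdeal k a))
        (pcbIdeal k a ⊔ Ideal.span {mono k α}) := by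
  have hrad := ha.radical_sup_span_mono (k := k) (by omega) hα
  have hne := ha.pcbIdeal_ne_laurentContraction (k := k) hn
  have hprim : (pcbIdeal k a ⊔ Ideal.span {mono k α}).IsPrimary :=
    Ideal.isPrimary_of_isMaximal_radical (hrad ▸ irrelevant_isMaximal)
  have hinf : pcbIdeal k a =
      laurentContraction (pcbIdeal k a) ⊓ (pcbIdeal k a ⊔ Ideal.span {mono k α}) := by
    refine eq_inf_sup_span_of_colon_eq Ideal.le_comap_map (fun f hf => ?_)
      (h.trans (ha.saturation_eq hα))
    rw [← ha.saturation_eq hα] at hf ⊢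
    obtain ⟨N, hN⟩ := hf
    exact ⟨N + 1, by rwa [pow_succ', ← mul_assoc]⟩
  refine ⟨⟨hprim, hrad, ?_, irrelevant_notMem_minimalPrimes ha (by omega)⟩, hinf, hne, fun e => ?_⟩
  · exact exists_isMinimalPrimaryDecomposition_of_inf hinf hne hprim
      (hrad ▸ X_mem_irrelevant ⟨0, by omega⟩) fun f => mem_laurentContraction_of_mul_X_mem
  · refine mono_notMem_pcbIdeal (k := k) (a := a) α ?_
    rw [e]
    exact Ideal.mem_sup_right (Ideal.mem_span_singleton_self _)

end Field

end PCB

end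

theorem theorem4p8 {k : Type*} [Field k] (n : ℕ) (hn : 4 ≤ n)
    (a : Matrix (Fin n) (Fin n) ℕ) (ha : PCB.IsPCB a) :
    (∀ α : Fin n → ℕ, α ≠ 0 →
      (PCB.pcbIdeal k a).colon {PCB.mono k α} =
        PCB.saturation (PCB.pcbIdeal k a) (PCB.mono k α) →
      PCB.IsEmbeddedComponent (PCB.pcbIdeal k a) (PCB.irrelevant k n)
          (PCB.pcbIdeal k a ⊔ Ideal.span {PCB.mono k α}) ∧
        PCB.IsIrredundantInter (PCB.pcbIdeal k a) (PCB.laurentContraction (PCB.pcbIdeal k a))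
          (PCB.pcbIdeal k a ⊔ Ideal.span {PCB.mono k α})) ∧
    (PCB.lastExponent a ≠ 0 ∧
      (PCB.pcbIdeal k a).colon {PCB.mono k (PCB.lastExponent a)} =
        PCB.saturation (PCB.pcbIdeal k a) (PCB.mono k (PCB.lastExponent a)) ∧
      PCB.IsEmbeddedComponent (PCB.pcbIdeal k a) (PCB.irrelevant k n)
          (PCB.pcbIdeal k a ⊔ Ideal.span {PCB.mono k (PCB.lastExponent a)}) ∧
        PCB.IsIrredundantInter (PCB.pcbIdeal k a) (PCB.laurentContraction (PCB.pcbIdeal k a))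
          (PCB.pcbIdeal k a ⊔ Ideal.span {PCB.mono k (PCB.lastExponent a)})) := by
  have hα := ha.lastExponent_ne_zero (by omega)
  have hcolon := PCB.colon_eq_saturation (k := k) ha (l := ⟨n - 1, by omega⟩)
    fun i hi => ha.sum_Iio_le_lastExponent fun h => hi (Fin.ext (Nat.eq_sub_of_add_eq h))
  exact ⟨fun α => ha.isEmbeddedComponent_and_isIrredundantInter hn, hα, hcolon,
    ha.isEmbeddedComponent_and_isIrredundantInter hn hα hcolon⟩
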